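/- Let $M\ge 1$ be an integer and let $\omega=x^M$ be the corresponding power word; for a group $G$ write $\omega(G)=\{g^M : g\in G\}$ for the image of the word map. Then there exists $N=N(\omega)$, depending only on $\omega$ (that is, on $M$), such that the following holds. Let $n\ge 1$ be an integer, let $q$ be a prime power, let $\varepsilon\in\{+,-\}$, and let $G\cong \mathrm{SL}_n^{\varepsilon}(q)$, where $\mathrm{SL}_n^{+}(q)=\mathrm{SL}_n(q)$ is the special linear group over the field with $q$ elements and $\mathrm{SL}_n^{-}(q)=\mathrm{SU}_n(q)$ is the special unitary group, i.e. the group of $n\times n$ matrices $A$ over the field with $q^2$ elements with $\det A=1$ and $\overline{A}^{\,T}A=1$, where $\overline{A}$ is obtained from $A$ by raising all entries to the power $q$. If $|G|\ge N$, then $$|\omega(G)|\ \ge\ \frac{|G|}{2nM}.$$ -/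

import Mathlib

/-- The word map `G ^ d → G`, `(g₁, …, g_d) ↦ ω(g₁, …, g_d)`, of a word `ω` in the free group on
`d` free generators. -/
def wordMap {d : ℕ} (w : FreeGroup (Fin d)) (G : Type*) [Group G] (g : Fin d → G) : G :=
  FreeGroup.lift g w

/-- The image `ω(G)` of the word map. -/
def wordImage {d : ℕ} (w : FreeGroup (Fin d)) (G : Type*) [Group G] : Set G :=
  Set.range (wordMap w G)

/-- The word `x ^ M` in one variable. -/
def powerWord (M : ℕ) : FreeGroup (Fin 1) := FreeGroup.of 0 ^ M

theorem mem_wordImage_powerWord {G : Type*} [Group G] (M : ℕ) (y : G) :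
    y ∈ wordImage (powerWord M) G ↔ ∃ g : G, g ^ M = y := by
  constructor
  · rintro ⟨g, rfl⟩
    exact ⟨g 0, by simp [wordMap, powerWord]⟩
  · rintro ⟨g, rfl⟩
    exact ⟨fun _ => g, by simp [wordMap, powerWord]⟩

/-- The group `SL_n(q)`, where `q = p ^ f`. -/
abbrev SLq (n p f : ℕ) [Fact p.Prime] : Type :=
  Matrix.SpecialLinearGroup (Fin n) (GaloisField p f)

/-- The special unitary group `SU_n(q)`, where `q = p ^ f`: the matrices `A` of determinant one over
the field with `q ^ 2` elements such that `Āᵀ A = 1`, where `Ā` is obtained from `A` by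
applying `x ↦ x ^ q` to the entries. -/
def SUq (n p f : ℕ) [Fact p.Prime] :
    Subgroup (Matrix.SpecialLinearGroup (Fin n) (GaloisField p (2 * f))) where
  carrier := {A | (A.1.map (fun x => x ^ p ^ f)).transpose * A.1 = 1}
  one_mem' := by
    have h : (1 : Matrix (Fin n) (Fin n) (GaloisField p (2 * f))).map
        (iterateFrobenius (GaloisField p (2 * f)) p f) = 1 :=
      Matrix.map_one _ (map_zero _) (map_one _)
    change ((1 : Matrix (Fin n) (Fin n) (GaloisField p (2 * f))).map
        (iterateFrobenius (GaloisField p (2 * f)) p f)).transpose * 1 = 1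
    rw [h, Matrix.transpose_one, one_mul]
  mul_mem' := by
    intro A B hA hB
    change (A.1.map (iterateFrobenius (GaloisField p (2 * f)) p f)).transpose * A.1 = 1 at hA
    change (B.1.map (iterateFrobenius (GaloisField p (2 * f)) p f)).transpose * B.1 = 1 at hB
    change ((A.1 * B.1).map
      (iterateFrobenius (GaloisField p (2 * f)) p f)).transpose * (A.1 * B.1) = 1
    rw [Matrix.map_mul, Matrix.transpose_mul, Matrix.mul_assoc, ← Matrix.mul_assoc _ A.1, hA,
      one_mul, hB]
  inv_mem' := by
    intro A hA
    change (A.1.map (iterateFrobenius (GaloisField p (2 * f)) p f)).transpose * A.1 = 1 at hA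
    change ((A⁻¹).1.map (iterateFrobenius (GaloisField p (2 * f)) p f)).transpose * (A⁻¹).1 = 1
    have h1 : A.1 * (A⁻¹).1 = 1 := congrArg Subtype.val (mul_inv_cancel A)
    have h3 : (A⁻¹).1 = (A.1.map (iterateFrobenius (GaloisField p (2 * f)) p f)).transpose := by
      have := congrArg (fun X => X * (A⁻¹).1) hA
      simp only [Matrix.mul_assoc, h1, one_mul, mul_one] at this
      exact this.symm
    have h4 : (A.1 * (A⁻¹).1).map (iterateFrobenius (GaloisField p (2 * f)) p f) = 1 := by
      rw [h1]
      exact Matrix.map_one _ (map_zero _) (map_one _)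
    rw [Matrix.map_mul] at h4
    have h5 := congrArg Matrix.transpose h4
    rw [Matrix.transpose_mul, ← h3, Matrix.transpose_one] at h5
    exact h5

/-!
The `M`-th powers are counted inside the conjugates of one cyclic maximal torus, the one belonging to
an `n`-cycle of the Weyl group. Put `Q = q` for `SL_n(q)` and `Q = -q` for `SU_n(q)`, and let `Ω` be an
algebraic closure. The torus `T` consists of the `a ∈ Ωˣ` with `a ^ (1 + Q + ⋯ + Q ^ (n - 1)) = 1`,
and `a` acts as a conjugate `W⁻¹ diag(a, a ^ Q, …, a ^ Q ^ (n - 1)) W` for a fixed matrix `W`.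

The two families of groups differ only in the choice of `W`. All that is used about it is that
`W⁻¹ diag(d) W`, for `d` of product one, lies in the group precisely when `x ↦ x ^ Q` permutes the
entries of `d` cyclically. Let `V` be the Vandermonde matrix with nodes `θ ^ q ^ i`, where `θ` has
order `q ^ n - 1`. Frobenius permutes its rows cyclically
(`exists_map_frobenius_eq_submatrix`), so `W = V` serves for `SL_n(q)`. For `SU_n(q)` take `W = V P`,
where `P` carries the Hermitian form with Gram matrix `Vᵀ V` to the standard one
(`exists_transpose_map_mul_submatrix_eq_one`); it exists since nondegenerate Hermitian forms over
finite fields have orthonormal bases (`exists_orthonormal_family`).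

Call `a ∈ T` regular if `a, a ^ Q, …, a ^ Q ^ (n - 1)` are distinct. The centralizer of a regular
element is `T`, and at most `n` elements of `T` are conjugate to it, as each of them is one of its
eigenvalues. Hence for every set `S` of regular `M`-th powers in `T` the group `G` satisfies
`|S| |G| ≤ n |T| |ω(G)|` (`card_mul_card_le_of_torus`). At least `|T| / M` elements of `T` are
`M`-th powers in `T`. Those which are not regular satisfy `a ^ Q ^ g = a` for some `g ≤ n / 2`, so they
number at most about `q ^ (n / 2)`, against `|T|` of size about `q ^ (n - 1)`; for `n = 2`, where this
is not enough, they even satisfy `a ^ 2 = 1`. So at least `|T| / (2 M)` regular `M`-th powers remain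
once `q ^ n` is large (`card_le_mul_ncard_powers`), and `q ^ n` is large when `|G|` is, because
`|G| ≤ (q ^ n) ^ (2 n)`.
-/

/-! ### Counting conjugates of regular elements -/

open Finset in
/-- If the centralizers of the elements of `S` lie in the image of `T`, and no conjugacy class contains
more than `n` elements of `S`, then the conjugates of `S` are numerous: the map
`(g, s) ↦ g * ρ s * g⁻¹` has fibres of at most `n * |T|` elements. -/
theorem card_mul_card_le_of_conj {G T : Type*} [Group G] [Finite G] [Group T] [Finite T]
    (ρ : T →* G) (S : Finset T) (n : ℕ) (X : Set G)
    (hcent : ∀ s ∈ S, ∀ g : G, g * ρ s = ρ s * g → g ∈ ρ.range)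
    (hconj : ∀ s ∈ S, ∃ R : Finset T, R.card ≤ n ∧ ∀ t ∈ S, IsConj (ρ s) (ρ t) → t ∈ R)
    (hX : ∀ s ∈ S, ∀ g : G, g * ρ s * g⁻¹ ∈ X) :
    S.card * Nat.card G ≤ n * Nat.card T * X.ncard := by
  classical
  have := Fintype.ofFinite G
  have := Fintype.ofFinite T
  let F : G × T → G := fun x => x.1 * ρ x.2 * x.1⁻¹
  have hXfin : X.Finite := Set.toFinite X
  have key : ((univ : Finset G) ×ˢ S).card ≤ (n * Nat.card T) * (hXfin.toFinset).card := by
    apply card_le_mul_card_image_of_maps_to (f := F)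
    · rintro ⟨g, s⟩ h
      simp only [mem_product, mem_univ, true_and] at h
      simpa [F] using hX s h g
    · intro y _
      rcases (filter (fun x => F x = y) (univ ×ˢ S)).eq_empty_or_nonempty with h0 | ⟨⟨g₀, s₀⟩, h₀⟩
      · simp only [h0, card_empty, Nat.zero_le]
      simp only [mem_filter, mem_product, mem_univ, true_and, F] at h₀
      obtain ⟨hs₀, rfl⟩ := h₀
      obtain ⟨R, hRn, hR⟩ := hconj s₀ hs₀
      have hle : (filter (fun x => F x = g₀ * ρ s₀ * g₀⁻¹) (univ ×ˢ S)).card ≤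
          Nat.card T * R.card := by
        apply card_le_mul_card_image_of_maps_to (f := Prod.snd)
        · rintro ⟨g, s⟩ h
          simp only [mem_filter, mem_product, mem_univ, true_and, F] at h
          refine hR s h.1 (isConj_iff.2 ⟨g⁻¹ * g₀, ?_⟩)
          have h2 := h.2
          calc g⁻¹ * g₀ * ρ s₀ * (g⁻¹ * g₀)⁻¹ = g⁻¹ * (g₀ * ρ s₀ * g₀⁻¹) * g := by group
            _ = ρ s := by rw [← h2]; group
        · intro s _
          -- two conjugating elements with the same outcome differ by an element of the centralizer
          rcases (filter (fun x : G × T => x.2 = s)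
            (filter (fun x => F x = g₀ * ρ s₀ * g₀⁻¹) (univ ×ˢ S))).eq_empty_or_nonempty with
            h0 | ⟨⟨g₁, s₁⟩, h₁⟩
          · simp only [h0, card_empty, Nat.zero_le]
          simp only [mem_filter, mem_product, mem_univ, true_and, F] at h₁
          obtain ⟨⟨hs₁, h₁⟩, rfl⟩ := h₁
          rw [← h₁, Nat.card_eq_fintype_card, ← card_univ]
          refine (card_le_card (t := univ.image (fun t : T => (g₁ * ρ t, s₁))) ?_).trans
            card_image_le
          rintro ⟨g, s⟩ h
          simp only [mem_filter, mem_product, mem_univ, true_and, F] at h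
          obtain ⟨⟨_, h⟩, rfl⟩ := h
          obtain ⟨t, ht⟩ := hcent s hs₁ (g₁⁻¹ * g) (by
            calc g₁⁻¹ * g * ρ s = g₁⁻¹ * (g * ρ s * g⁻¹) * g := by group
              _ = ρ s * (g₁⁻¹ * g) := by rw [h]; group)
          simp only [mem_image, mem_univ, true_and]
          exact ⟨t, by rw [ht]; simp⟩
      calc _ ≤ _ := hle
        _ ≤ n * Nat.card T := by rw [mul_comm]; exact Nat.mul_le_mul_right _ hRn
  rw [card_product, card_univ, ← Nat.card_eq_fintype_card,
    ← Set.ncard_eq_toFinset_card X hXfin] at key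
  rwa [mul_comm S.card]

/-! ### The cyclic torus attached to a Coxeter element -/

/-- `1 + Q + ⋯ + Q ^ (n - 1)`, which for `Q = ± q` is up to sign the order of the torus. -/
def geomSum (Q : ℤ) (n : ℕ) : ℤ := ∑ i ∈ Finset.range n, Q ^ i

/-- The group of all `a` with `a ^ (1 + Q + ⋯ + Q ^ (n - 1)) = 1`, written as a group of roots of
unity with natural exponent, since `Q` may be negative. -/
abbrev torus (Ω : Type*) [Field Ω] (Q : ℤ) (n : ℕ) : Subgroup Ωˣ :=
  rootsOfUnity (geomSum Q n).natAbs Ω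

/-- The eigenvalues `a, a ^ Q, a ^ Q², …` attached to `a`. -/
def twistedOrbit {Ω : Type*} [Field Ω] (Q : ℤ) (n : ℕ) (a : Ωˣ) (i : Fin n) : Ωˣ :=
  a ^ (Q ^ (i : ℕ))

section
variable {Ω : Type*} [Field Ω] {Q : ℤ}

theorem mem_torus {n : ℕ} {a : Ωˣ} : a ∈ torus Ω Q n ↔ a ^ geomSum Q n = 1 := by
  rw [mem_rootsOfUnity, pow_natAbs_eq_one]

/-- By this identity `x ↦ x ^ Q` permutes the orbit of `a` cyclically. -/
theorem zpow_pow_eq_self_of_mem_torus {n : ℕ} {a : Ωˣ} (ha : a ∈ torus Ω Q n) :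
    a ^ (Q ^ n) = a := by
  have h : Q ^ n = geomSum Q n * (Q - 1) + 1 := by rw [geomSum, geom_sum_mul]; ring
  rw [h, zpow_add, zpow_mul, mem_torus.1 ha, one_zpow, zpow_one, one_mul]

theorem prod_twistedOrbit (n : ℕ) (a : Ωˣ) :
    ∏ i, twistedOrbit Q n a i = a ^ geomSum Q n := by
  simp only [twistedOrbit, geomSum]
  rw [Fin.prod_univ_eq_prod_range (fun i => a ^ (Q ^ i))]
  induction n with
  | zero => simp
  | succ n ih => rw [Finset.prod_range_succ, Finset.sum_range_succ, zpow_add, ih]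

theorem twistedOrbit_finRotate {k : ℕ} {a : Ωˣ} (ha : a ∈ torus Ω Q (k + 1)) (i : Fin (k + 1)) :
    twistedOrbit Q (k + 1) a (finRotate _ i) = twistedOrbit Q (k + 1) a i ^ Q := by
  simp only [twistedOrbit]
  rw [← zpow_mul, ← pow_succ]
  by_cases hi : i = Fin.last k
  · subst hi
    rw [finRotate_last, Fin.val_last, zpow_pow_eq_self_of_mem_torus ha]
    simp
  · rw [coe_finRotate_of_ne_last hi]

/-- The families permuted cyclically by `x ↦ x ^ Q`, of product one, are the orbits of the
elements of the torus. -/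
theorem eq_twistedOrbit {k : ℕ} {d : Fin (k + 1) → Ωˣ}
    (hd : ∀ i, d (finRotate _ i) = d i ^ Q) (h1 : ∏ i, d i = 1) :
    d 0 ∈ torus Ω Q (k + 1) ∧ d = twistedOrbit Q (k + 1) (d 0) := by
  have h : ∀ i : ℕ, ∀ hi : i < k + 1, d ⟨i, hi⟩ = d 0 ^ (Q ^ i) := by
    intro i
    induction i with
    | zero => intro _; simp
    | succ i ih =>
      intro hi
      rw [← finRotate_of_lt (Nat.lt_of_succ_lt_succ hi), hd, ih, pow_succ, zpow_mul]
  have h2 : d = twistedOrbit Q (k + 1) (d 0) := funext fun i => h i i.2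
  refine ⟨?_, h2⟩
  rw [mem_torus, ← prod_twistedOrbit, ← h2, h1]

open Matrix in
/-- A matrix commuting with a diagonal matrix with distinct entries is diagonal. -/
theorem eq_diagonal_of_commute {n : Type*} [Fintype n] [DecidableEq n] {d : n → Ω}
    (hd : Function.Injective d) {B : Matrix n n Ω} (h : B * diagonal d = diagonal d * B) :
    B = diagonal (fun i => B i i) := by
  ext i j
  by_cases hij : i = j
  · subst hij; simp
  · have := congrFun (congrFun h i) j
    rw [mul_diagonal, diagonal_mul, mul_comm] at this
    have h2 : (d j - d i) * B i j = 0 := by rw [sub_mul, this, sub_self]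
    rcases mul_eq_zero.1 h2 with h3 | h3
    · exact absurd (hd (sub_eq_zero.1 h3)).symm hij
    · rw [h3, diagonal_apply_ne _ hij]

open Matrix in
/-- The count of conjugates for regular `M`-th powers in the torus. Here `G` is a group of matrices of
determinant one which contains `W⁻¹ diag(d) W`, for `d` of product one, exactly when `x ↦ x ^ Q`
permutes the entries of `d` cyclically. -/
theorem card_mul_card_le_of_torus {k : ℕ} {G : Type*} [Group G] [Finite G]
    (j : G →* Matrix (Fin (k + 1)) (Fin (k + 1)) Ω) (hj : Function.Injective j)
    (hdet : ∀ g, (j g).det = 1) (W : (Matrix (Fin (k + 1)) (Fin (k + 1)) Ω)ˣ)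
    (hW : ∀ d : Fin (k + 1) → Ωˣ, ∏ i, d i = 1 →
      ((∃ g, j g = W⁻¹.1 * diagonal (fun i => (d i : Ω)) * W.1) ↔
        ∀ i, d (finRotate _ i) = d i ^ Q))
    [Finite (torus Ω Q (k + 1))] (M : ℕ) (S : Finset (torus Ω Q (k + 1)))
    (hS : ∀ a ∈ S, Function.Injective (twistedOrbit Q (k + 1) a.1) ∧ ∃ b, b ^ M = a) :
    S.card * Nat.card G ≤
      (k + 1) * Nat.card (torus Ω Q (k + 1)) * {y : G | ∃ g, g ^ M = y}.ncard := by
  classical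
  have hex : ∀ a : torus Ω Q (k + 1), ∃ g, j g =
      W⁻¹.1 * diagonal (fun i => (twistedOrbit Q (k + 1) a.1 i : Ω)) * W.1 := fun a =>
    (hW _ (by rw [prod_twistedOrbit]; exact mem_torus.1 a.2)).2 (twistedOrbit_finRotate a.2)
  choose r hr using hex
  let ρ : torus Ω Q (k + 1) →* G := MonoidHom.mk' r (by
    intro a b
    apply hj
    rw [map_mul, hr, hr, hr]
    have : ∀ A B : Matrix (Fin (k + 1)) (Fin (k + 1)) Ω,
        W⁻¹.1 * A * W.1 * (W⁻¹.1 * B * W.1) = W⁻¹.1 * (A * B) * W.1 := by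
      intro A B
      simp only [Matrix.mul_assoc, Units.mul_inv_cancel_left]
    rw [this, diagonal_mul_diagonal]
    congr 3
    funext i
    simp [twistedOrbit, mul_zpow])
  have hρ : ∀ a, j (ρ a) =
      W⁻¹.1 * diagonal (fun i => (twistedOrbit Q (k + 1) a.1 i : Ω)) * W.1 := hr
  refine card_mul_card_le_of_conj ρ S (k + 1) _ ?_ ?_ ?_
  · intro a ha g hg
    have hg' := congrArg j hg
    rw [map_mul, map_mul, hρ] at hg'
    -- `W * j g * W⁻¹` commutes with a diagonal matrix with distinct entries, so it is diagonal
    set D := diagonal (fun i => (twistedOrbit Q (k + 1) a.1 i : Ω)) with hD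
    have hcomm : (W.1 * j g * W⁻¹.1) * D = D * (W.1 * j g * W⁻¹.1) := by
      calc (W.1 * j g * W⁻¹.1) * D = W.1 * (j g * (W⁻¹.1 * D * W.1)) * W⁻¹.1 := by
            simp only [Matrix.mul_assoc, Units.mul_inv, Matrix.mul_one]
        _ = D * (W.1 * j g * W⁻¹.1) := by
            rw [hg']
            simp only [Matrix.mul_assoc, Units.mul_inv_cancel_left]
    have hdiag := eq_diagonal_of_commute
      (fun x y h => (hS a ha).1 (Units.ext h)) hcomm
    set e : Fin (k + 1) → Ω := fun i => (W.1 * j g * W⁻¹.1) i i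
    have hjg : j g = W⁻¹.1 * diagonal e * W.1 := by
      rw [← hdiag]
      simp only [Matrix.mul_assoc, Units.inv_mul, Units.inv_mul_cancel_left, Matrix.mul_one]
    have hprod : ∏ i, e i = 1 := by
      rw [← det_diagonal, ← hdiag, det_mul_comm, ← Matrix.mul_assoc, Units.inv_mul,
        Matrix.one_mul, hdet]
    have he : ∀ i, e i ≠ 0 := fun i h0 => by
      rw [Finset.prod_eq_zero (Finset.mem_univ i) h0] at hprod
      exact zero_ne_one hprod
    let d : Fin (k + 1) → Ωˣ := fun i => Units.mk0 (e i) (he i)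
    have hd1 : ∏ i, d i = 1 := by
      apply Units.ext
      simpa [d] using hprod
    have hd := (hW d hd1).1 ⟨g, hjg⟩
    obtain ⟨h0, h1⟩ := eq_twistedOrbit hd hd1
    refine ⟨⟨d 0, h0⟩, hj ?_⟩
    rw [hρ, hjg]
    simp only
    rw [← h1]
    rfl
  · intro a _
    -- the eigenvalues of `ρ a`, with junk value `1` outside the torus
    refine ⟨Finset.univ.image
      (fun i : Fin (k + 1) => if h : twistedOrbit Q (k + 1) a.1 i ∈ torus Ω Q (k + 1)
        then (⟨_, h⟩ : torus Ω Q (k + 1)) else 1), ?_, ?_⟩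
    · exact Finset.card_image_le.trans (by simp)
    · intro b _ hab
      obtain ⟨c, hc⟩ := isConj_iff.1 hab
      have hc' := congrArg j hc
      rw [map_mul, map_mul, hρ, hρ] at hc'
      -- conjugate matrices have the same characteristic polynomial, hence the same eigenvalues
      have hcp := congrArg charpoly hc'
      have e1 : ∀ A, (W⁻¹.1 * A * W.1).charpoly = A.charpoly := fun A => by
        rw [charpoly_mul_comm, ← Matrix.mul_assoc, Units.mul_inv, Matrix.one_mul]
      rw [e1, charpoly_mul_comm, ← Matrix.mul_assoc, ← map_mul, inv_mul_cancel, map_one,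
        Matrix.one_mul, e1, charpoly_diagonal, charpoly_diagonal] at hcp
      have hev := congrArg (Polynomial.eval (b.1 : Ω)) hcp
      have h0 : ∏ i, Polynomial.eval (b.1 : Ω)
          (Polynomial.X - Polynomial.C (twistedOrbit Q (k + 1) b.1 i : Ω)) = 0 :=
        Finset.prod_eq_zero (Finset.mem_univ 0) (by simp [twistedOrbit])
      rw [Polynomial.eval_prod, Polynomial.eval_prod, h0] at hev
      obtain ⟨i, _, hi⟩ := Finset.prod_eq_zero_iff.1 hev
      have hi' : (b.1 : Ωˣ) = twistedOrbit Q (k + 1) a.1 i := by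
        apply Units.ext
        simpa [sub_eq_zero] using hi
      have hm : twistedOrbit Q (k + 1) a.1 i ∈ torus Ω Q (k + 1) := hi' ▸ b.2
      simp only [Finset.mem_image, Finset.mem_univ, true_and]
      exact ⟨i, by rw [dif_pos hm]; exact Subtype.ext hi'.symm⟩
  · intro a ha g
    obtain ⟨b, rfl⟩ := (hS a ha).2
    exact ⟨g * ρ b * g⁻¹, by rw [conj_pow, map_pow]⟩

end

/-! ### Elements of the torus with repeated eigenvalues -/

section
variable {Ω : Type*} [Field Ω] {Q : ℤ}

/-- If the orbit of `a` under `x ↦ x ^ Q` has fewer than `n` members, then the period of `a` is a proper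
divisor of `n`, so at most `n / 2`. -/
theorem exists_zpow_pow_eq_self {n : ℕ} {a : Ωˣ} (ha : a ∈ torus Ω Q n)
    (hreg : ¬ Function.Injective (twistedOrbit Q n a)) :
    ∃ g ∈ Finset.Icc 1 (n / 2), a ^ (Q ^ g) = a := by
  have hn : 0 < n := by
    rcases Nat.eq_zero_or_pos n with rfl | h
    · exact absurd (fun x => x.elim0) hreg
    · exact h
  have hit : ∀ i : ℕ, (fun x : Ωˣ => x ^ Q)^[i] a = a ^ (Q ^ i) := by
    intro i
    induction i with
    | zero => simp
    | succ i ih => rw [Function.iterate_succ_apply', ih, pow_succ, zpow_mul]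
  have hper : Function.IsPeriodicPt (fun x : Ωˣ => x ^ Q) n a := by
    rw [Function.IsPeriodicPt, Function.IsFixedPt, hit, zpow_pow_eq_self_of_mem_torus ha]
  have hpos := hper.minimalPeriod_pos hn
  obtain ⟨c, hc⟩ := hper.minimalPeriod_dvd
  set g := Function.minimalPeriod (fun x : Ωˣ => x ^ Q) a with hg
  have hgn : g ≠ n := by
    intro h
    apply hreg
    intro i j hij
    have := Function.iterate_injOn_Iio_minimalPeriod (f := fun x : Ωˣ => x ^ Q) (x := a)
    rw [← hg, h] at this
    refine Fin.ext (this i.2 j.2 ?_)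
    simpa [hit, twistedOrbit] using hij
  refine ⟨g, Finset.mem_Icc.2 ⟨hpos, ?_⟩, ?_⟩
  · have hc2 : 2 ≤ c := by
      rcases c with _ | _ | c
      · omega
      · omega
      · omega
    rw [Nat.le_div_iff_mul_le two_pos, hc]
    exact Nat.mul_le_mul_left _ hc2
  · rw [← hit]
    exact Function.isPeriodicPt_minimalPeriod _ _

theorem ncard_setOf_zpow_eq_one_le (m : ℤ) (hm : m ≠ 0) :
    {a : Ωˣ | a ^ m = 1}.Finite ∧ {a : Ωˣ | a ^ m = 1}.ncard ≤ m.natAbs := by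
  have : NeZero m.natAbs := ⟨Int.natAbs_ne_zero.2 hm⟩
  have h : {a : Ωˣ | a ^ m = 1} = (rootsOfUnity m.natAbs Ω : Set Ωˣ) := by
    ext a
    simp [mem_rootsOfUnity, pow_natAbs_eq_one]
  rw [h]
  exact ⟨(inferInstance : Finite (rootsOfUnity m.natAbs Ω)), card_rootsOfUnity Ω m.natAbs⟩

theorem natAbs_pow_sub_one_bounds (hQ : 2 ≤ Q.natAbs) {g : ℕ} (hg : 1 ≤ g) :
    Q ^ g - 1 ≠ 0 ∧ (Q ^ g - 1).natAbs ≤ Q.natAbs ^ g + 1 ∧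
      Q.natAbs ^ g - 1 ≤ (Q ^ g - 1).natAbs := by
  have h2 : 2 ≤ Q.natAbs ^ g := hQ.trans (Nat.le_self_pow (by omega) _)
  rw [← Int.natAbs_pow] at *
  omega

theorem ncard_nonregular_le (hQ : 2 ≤ Q.natAbs) (n : ℕ) :
    {a : Ωˣ | a ∈ torus Ω Q n ∧ ¬ Function.Injective (twistedOrbit Q n a)}.ncard ≤
      ∑ g ∈ Finset.Icc 1 (n / 2), (Q.natAbs ^ g + 1) := by
  have hsub : {a : Ωˣ | a ∈ torus Ω Q n ∧ ¬ Function.Injective (twistedOrbit Q n a)} ⊆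
      ⋃ g ∈ Finset.Icc 1 (n / 2), {a : Ωˣ | a ^ (Q ^ g - 1) = 1} := by
    rintro a ⟨ha, hreg⟩
    obtain ⟨g, hg, h⟩ := exists_zpow_pow_eq_self ha hreg
    simp only [Set.mem_iUnion]
    exact ⟨g, hg, by simp [zpow_sub, h]⟩
  have hfin : (⋃ g ∈ Finset.Icc 1 (n / 2), {a : Ωˣ | a ^ (Q ^ g - 1) = 1}).Finite :=
    Set.Finite.biUnion (Finset.finite_toSet _) fun g hg =>
      (ncard_setOf_zpow_eq_one_le _
        (natAbs_pow_sub_one_bounds hQ (Finset.mem_Icc.1 hg).1).1).1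
  refine (Set.ncard_le_ncard hsub hfin).trans
    ((Finset.set_ncard_biUnion_le _ _).trans (Finset.sum_le_sum fun g hg => ?_))
  obtain ⟨h0, h1, _⟩ := natAbs_pow_sub_one_bounds (Q := Q) hQ (Finset.mem_Icc.1 hg).1
  exact (ncard_setOf_zpow_eq_one_le _ h0).2.trans h1

/-- For `n = 2` the elements with repeated eigenvalues satisfy `a ^ 2 = 1`. -/
theorem ncard_nonregular_two_le :
    {a : Ωˣ | a ∈ torus Ω Q 2 ∧ ¬ Function.Injective (twistedOrbit Q 2 a)}.ncard ≤ 2 := by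
  refine (Set.ncard_le_ncard ?_ (ncard_setOf_zpow_eq_one_le (Ω := Ω) 2 two_ne_zero).1).trans
    (ncard_setOf_zpow_eq_one_le (Ω := Ω) 2 two_ne_zero).2
  rintro a ⟨ha, hreg⟩
  obtain ⟨g, hg, h⟩ := exists_zpow_pow_eq_self ha hreg
  obtain rfl : g = 1 := by rw [Finset.mem_Icc] at hg; omega
  have h1 := mem_torus.1 ha
  simp only [geomSum, Finset.sum_range_succ, Finset.sum_range_zero, zpow_add, h] at h1
  change a ^ (2 : ℤ) = 1
  rw [zpow_two]
  simpa using h1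

/-- The order of the torus is `|Q ^ n - 1| / |Q - 1|`, which is at least `(q ^ n - 1) / (q + 1)`. -/
theorem pow_sub_one_le_natAbs_geomSum (hQ : 2 ≤ Q.natAbs) {n : ℕ} (hn : 1 ≤ n) :
    Q.natAbs ^ n - 1 ≤ (geomSum Q n).natAbs * (Q.natAbs + 1) := by
  refine (natAbs_pow_sub_one_bounds hQ hn).2.2.trans ?_
  rw [← geom_sum_mul, Int.natAbs_mul]
  refine Nat.mul_le_mul_left _ ?_
  omega

theorem sum_pow_add_one_le {q : ℕ} (hq : 2 ≤ q) (h : ℕ) :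
    ∑ g ∈ Finset.Icc 1 h, (q ^ g + 1) ≤ 3 * q ^ h := by
  induction h with
  | zero => simp
  | succ h ih =>
    rw [Finset.sum_Icc_succ_top (by omega)]
    have h1 : 1 ≤ q ^ h := Nat.one_le_pow _ _ (by omega)
    have h2 : 2 * q ^ h ≤ q ^ (h + 1) := by rw [pow_succ]; nlinarith
    omega

/-- The numerical estimate: if `q ^ n` is large in terms of `M`, then the number `c` of elements with
repeated eigenvalues is at most a fraction `1 / (2 * M)` of the order `m` of the torus. -/
theorem two_mul_mul_le {q n M m c : ℕ} (hq : 2 ≤ q) (hn : 2 ≤ n) (hM : 1 ≤ M)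
    (hbig : (24 * M) ^ 4 ≤ q ^ n) (hm : q ^ n - 1 ≤ m * (q + 1))
    (hc2 : n = 2 → c ≤ 2) (hc : c ≤ ∑ g ∈ Finset.Icc 1 (n / 2), (q ^ g + 1)) :
    2 * M * c ≤ m := by
  rcases hn.eq_or_lt with rfl | hn3
  · have hc2 := hc2 rfl
    have h1 : 24 * M < q := by
      have h3 : (24 * M) ^ 2 ≤ q := by
        refine (Nat.pow_le_pow_iff_left (n := 2) two_ne_zero).1 ?_
        rw [← pow_mul]
        exact hbig
      nlinarith
    have h2 : q - 1 ≤ m := by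
      have h3 : (q - 1) * (q + 1) ≤ m * (q + 1) := by
        refine le_trans (le_of_eq ?_) hm
        obtain ⟨r, rfl⟩ : ∃ r, q = r + 1 := ⟨q - 1, by omega⟩
        have : (r + 1) ^ 2 = r * (r + 1 + 1) + 1 := by ring
        rw [this]; simp
      exact Nat.le_of_mul_le_mul_right h3 (by omega)
    have h4 : 2 * M * c ≤ 2 * M * 2 := Nat.mul_le_mul_left _ hc2
    omega
  · set h := n / 2 with hh
    have hc3 := hc.trans (sum_pow_add_one_le hq h)
    -- for `3 ≤ n` the exponent `e` is at least `n / 4`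
    obtain ⟨e, he⟩ : ∃ e, n = e + (h + 1) := ⟨n - (h + 1), by omega⟩
    have h1 : 24 * M ≤ q ^ e := by
      refine (Nat.pow_le_pow_iff_left (n := 4) four_ne_zero).1 (hbig.trans ?_)
      rw [← pow_mul]
      exact Nat.pow_le_pow_right (by omega) (by omega)
    have h2 : 24 * M * q ^ (h + 1) ≤ q ^ n := by
      rw [he, pow_add q e]
      exact Nat.mul_le_mul_right _ h1
    have h3 : 2 * M * c * (q + 1) ≤ m * (q + 1) := by
      refine le_trans ?_ hm
      have h4 : 2 * M * c * (q + 1) ≤ 2 * M * (3 * q ^ h) * (2 * q) :=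
        Nat.mul_le_mul (Nat.mul_le_mul_left _ hc3) (by omega)
      have h5 : 2 * M * (3 * q ^ h) * (2 * q) = 12 * (M * q ^ (h + 1)) := by ring
      have h6 : 1 ≤ M * q ^ (h + 1) := Nat.mul_pos hM (Nat.pow_pos (by omega))
      rw [mul_assoc] at h2
      omega
    exact Nat.le_of_mul_le_mul_right h3 (by omega)

/-! ### Powers in groups containing the torus -/

/-- A group of elements of `Ω` loses at most a factor `M` under `x ↦ x ^ M`. -/
theorem card_le_mul_card_image_pow [DecidableEq Ω] (T : Subgroup Ωˣ) [Fintype T] {M : ℕ}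
    (hM : 1 ≤ M) :
    Fintype.card T ≤ M * (Finset.univ.image (fun x : T => x ^ M)).card := by
  rw [← Finset.card_univ]
  refine Finset.card_le_mul_card_image _ M fun y _ => ?_
  have hinj : Function.Injective (fun x : T => ((x : Ωˣ) : Ω)) := fun x y h =>
    Subtype.ext (Units.ext h)
  rw [← Finset.card_image_of_injective _ hinj]
  refine le_trans (Finset.card_le_card (t := (Polynomial.nthRoots M ((y : Ωˣ) : Ω)).toFinset) ?_)
    ((Multiset.toFinset_card_le _).trans (Polynomial.card_nthRoots _ _))
  intro z hz
  simp only [Finset.mem_image, Finset.mem_filter, Finset.mem_univ, true_and] at hz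
  obtain ⟨x, rfl, rfl⟩ := hz
  rw [Multiset.mem_toFinset, Polynomial.mem_nthRoots hM]
  simp

open Matrix in
/-- A group of matrices over an algebraically closed field which meets a conjugate of the diagonal
torus exactly in the families permuted cyclically by `x ↦ x ^ Q` has many `M`-th powers. -/
theorem card_le_mul_ncard_powers [IsAlgClosed Ω] {k : ℕ} (hk : 1 ≤ k) {G : Type*} [Group G]
    [Finite G] (hQ : 2 ≤ Q.natAbs) (hQ0 : (Q : Ω) = 0)
    (j : G →* Matrix (Fin (k + 1)) (Fin (k + 1)) Ω) (hj : Function.Injective j)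
    (hdet : ∀ g, (j g).det = 1) (W : (Matrix (Fin (k + 1)) (Fin (k + 1)) Ω)ˣ)
    (hW : ∀ d : Fin (k + 1) → Ωˣ, ∏ i, d i = 1 →
      ((∃ g, j g = W⁻¹.1 * diagonal (fun i => (d i : Ω)) * W.1) ↔
        ∀ i, d (finRotate _ i) = d i ^ Q))
    {M : ℕ} (hM : 1 ≤ M) (hbig : (24 * M) ^ 4 ≤ Q.natAbs ^ (k + 1)) :
    Nat.card G ≤ 2 * (k + 1) * M * {y : G | ∃ g, g ^ M = y}.ncard := by
  classical
  set m := (geomSum Q (k + 1)).natAbs with hm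
  -- the order of the torus is prime to the characteristic, as it is congruent to `± 1` modulo `Q`
  have hcast : ((geomSum Q (k + 1) : ℤ) : Ω) = 1 := by
    rw [geomSum, Finset.sum_range_succ']
    push_cast
    simp [hQ0]
  have hm0 : NeZero (m : Ω) := ⟨fun h => by
    have h2 : ((m : ℤ) : Ω) = 0 := by exact_mod_cast h
    rw [hm] at h2
    rcases Int.natAbs_eq (geomSum Q (k + 1)) with h3 | h3
    · rw [← h3, hcast] at h2; exact one_ne_zero h2
    · rw [h3, Int.cast_neg, h2, neg_zero] at hcast; exact zero_ne_one hcast⟩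
  have hm1 : NeZero m := ⟨fun h => hm0.out (by rw [h, Nat.cast_zero])⟩
  have hcard : Nat.card (torus Ω Q (k + 1)) = m := by
    obtain ⟨ζ, hζ⟩ := HasEnoughRootsOfUnity.exists_primitiveRoot Ω m
    exact hζ.card_rootsOfUnity
  have := Fintype.ofFinite (torus Ω Q (k + 1))
  set P := Finset.univ.image (fun x : torus Ω Q (k + 1) => x ^ M)
  set S := P.filter (fun a => Function.Injective (twistedOrbit Q (k + 1) a.1))
  set R := P.filter (fun a => ¬ Function.Injective (twistedOrbit Q (k + 1) a.1))
  set B := {a : Ωˣ | a ∈ torus Ω Q (k + 1) ∧ ¬ Function.Injective (twistedOrbit Q (k + 1) a)}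
  have hR : R.card ≤ B.ncard := by
    have hBfin : B.Finite := (Set.toFinite (torus Ω Q (k + 1) : Set Ωˣ)).subset fun a ha => ha.1
    rw [Set.ncard_eq_toFinset_card _ hBfin]
    refine Finset.card_le_card_of_injOn (fun a => a.1) ?_ (fun x _ y _ h => Subtype.ext h)
    intro a ha
    have ha := (Finset.mem_filter.1 ha).2
    simpa [B] using ⟨mem_torus.1 a.2, ha⟩
  have hP : m ≤ M * P.card := by
    rw [← hcard, Nat.card_eq_fintype_card]
    exact card_le_mul_card_image_pow _ hM
  have hB : 2 * M * B.ncard ≤ m :=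
    two_mul_mul_le hQ (by omega) hM hbig (pow_sub_one_le_natAbs_geomSum hQ (by omega))
      (fun h => by
        obtain rfl : k = 1 := by omega
        exact ncard_nonregular_two_le)
      (ncard_nonregular_le hQ _)
  have hsum : S.card + R.card = P.card := Finset.card_filter_add_card_filter_not _
  have hS : m ≤ 2 * M * S.card := by
    have h1 : M * R.card ≤ M * B.ncard := Nat.mul_le_mul_left _ hR
    rw [← hsum, mul_add] at hP
    rw [mul_assoc] at hB ⊢
    omega
  have key := card_mul_card_le_of_torus j hj hdet W hW M S (fun a ha => by
    obtain ⟨h1, h2⟩ := Finset.mem_filter.1 ha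
    obtain ⟨b, _, hb⟩ := Finset.mem_image.1 h1
    exact ⟨h2, b, hb⟩)
  rw [hcard] at key
  have hmpos : 0 < m := Nat.pos_of_ne_zero hm1.out
  refine Nat.le_of_mul_le_mul_left ?_ hmpos
  calc m * Nat.card G ≤ 2 * M * S.card * Nat.card G := Nat.mul_le_mul_right _ hS
    _ = 2 * M * (S.card * Nat.card G) := by ring
    _ ≤ 2 * M * ((k + 1) * m * {y : G | ∃ g, g ^ M = y}.ncard) := Nat.mul_le_mul_left _ key
    _ = m * (2 * (k + 1) * M * {y : G | ∃ g, g ^ M = y}.ncard) := by ring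
end

/-! ### Frobenius and conjugates of diagonal matrices -/

open Matrix

/-- A matrix of Vandermonde type whose rows are permuted cyclically by the Frobenius map. -/
theorem exists_map_frobenius_eq_submatrix {Ω : Type*} [Field Ω] [IsAlgClosed Ω] {k q : ℕ}
    (hk : 1 ≤ k) (hq : 2 ≤ q) (hq0 : (q : Ω) = 0) (φ : Ω →+* Ω) (hφ : ∀ x, φ x = x ^ q) :
    ∃ V : (Matrix (Fin (k + 1)) (Fin (k + 1)) Ω)ˣ,
      V.1.map φ = V.1.submatrix (finRotate (k + 1)) id := by
  have h1 : 2 * q ^ k ≤ q ^ (k + 1) := by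
    rw [pow_succ, mul_comm]; exact Nat.mul_le_mul_left _ hq
  have h2 : 2 ≤ q ^ k := hq.trans (Nat.le_self_pow (by omega) _)
  have hne : NeZero ((q ^ (k + 1) - 1 : ℕ) : Ω) := ⟨by
    rw [Nat.cast_sub (by omega)]
    simp [hq0]⟩
  obtain ⟨θ, hθ⟩ := HasEnoughRootsOfUnity.exists_primitiveRoot Ω (q ^ (k + 1) - 1)
  have hθq : θ ^ q ^ (k + 1) = θ := by
    obtain ⟨r, hr⟩ : ∃ r, q ^ (k + 1) = r + 1 := ⟨q ^ (k + 1) - 1, by omega⟩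
    rw [hr] at hθ ⊢
    have := hθ.pow_eq_one
    rw [Nat.add_sub_cancel] at this
    rw [pow_succ, this, one_mul]
  let v : Fin (k + 1) → Ω := fun i => θ ^ q ^ (i : ℕ)
  have hv : Function.Injective v := by
    intro i j hij
    have hlt : ∀ i : Fin (k + 1), q ^ (i : ℕ) < q ^ (k + 1) - 1 := fun i =>
      lt_of_le_of_lt (Nat.pow_le_pow_right (by omega) (Nat.lt_succ_iff.1 i.2)) (by omega)
    exact Fin.ext (Nat.pow_right_injective hq (hθ.pow_inj (hlt i) (hlt j) hij))
  have hdet : IsUnit (vandermonde v).det := (det_vandermonde_ne_zero_iff.2 hv).isUnit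
  obtain ⟨V, hV⟩ := (isUnit_iff_isUnit_det _).2 hdet
  refine ⟨V, ?_⟩
  rw [hV]
  ext i j
  have hrot : v (finRotate _ i) = v i ^ q := by
    simp only [v]
    rw [← pow_mul, ← pow_succ]
    by_cases hi : i = Fin.last k
    · subst hi
      rw [finRotate_last, Fin.val_last, hθq]
      simp
    · rw [coe_finRotate_of_ne_last hi]
  simp only [map_apply, submatrix_apply, vandermonde_apply, hφ, id, hrot]
  exact pow_right_comm _ _ _

section
variable {Ω : Type*} [Field Ω] {n : Type*} [Fintype n] [DecidableEq n]

theorem conj_diagonal_eq_submatrix (W : (Matrix n n Ω)ˣ) (σ : Equiv.Perm n) (d : n → Ω) :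
    W.1.submatrix σ id * (W⁻¹.1 * diagonal d * W.1) =
      diagonal (d ∘ σ) * W.1.submatrix σ id := by
  have h : W.1 * (W⁻¹.1 * diagonal d * W.1) = diagonal d * W.1 := by
    rw [Matrix.mul_assoc W⁻¹.1, Units.mul_inv_cancel_left]
  have h1 := congrArg (fun X => X.submatrix σ id) h
  rw [← submatrix_mul_equiv _ _ σ (Equiv.refl n) id,
    ← submatrix_mul_equiv (diagonal d) _ σ σ id] at h1
  simpa only [Equiv.coe_refl, submatrix_id_id, submatrix_diagonal_equiv] using h1

theorem isUnit_submatrix_left (W : (Matrix n n Ω)ˣ) (σ : Equiv.Perm n) :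
    IsUnit (W.1.submatrix σ id) := by
  have h : W.1.submatrix σ id * W⁻¹.1.submatrix id σ = 1 := by
    have := submatrix_mul_equiv W.1 W⁻¹.1 σ (Equiv.refl n) σ
    rw [Units.mul_inv, submatrix_one_equiv] at this
    simpa using this
  exact IsUnit.of_mul_eq_one _ h

/-- If the Frobenius map permutes the rows of `W`, then the conjugate of a diagonal matrix by `W` is
fixed by Frobenius precisely when Frobenius permutes the diagonal in the same way. -/
theorem map_conj_diagonal_eq_self_iff (φ : Ω →+* Ω) (W : (Matrix n n Ω)ˣ) (σ : Equiv.Perm n)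
    (hW : W.1.map φ = W.1.submatrix σ id) (d : n → Ω) :
    (W⁻¹.1 * diagonal d * W.1).map φ = W⁻¹.1 * diagonal d * W.1 ↔ ∀ i, d (σ i) = φ (d i) := by
  have hu := isUnit_submatrix_left W σ
  have h1 : W.1.submatrix σ id * (W⁻¹.1 * diagonal d * W.1).map φ =
      diagonal (φ ∘ d) * W.1.submatrix σ id := by
    rw [← hW, ← Matrix.map_mul, Matrix.mul_assoc W⁻¹.1, Units.mul_inv_cancel_left,
      Matrix.map_mul, diagonal_map (map_zero φ)]
    rfl
  rw [← hu.mul_right_inj, h1, conj_diagonal_eq_submatrix, hu.mul_left_inj, diagonal_eq_diagonal_iff]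
  exact ⟨fun h i => (h i).symm, fun h i => (h i).symm⟩

/-- The analogue of `map_conj_diagonal_eq_self_iff` for the composition of Frobenius and inverse
transpose. -/
theorem transpose_map_conj_diagonal_mul_eq_one_iff (φ : Ω →+* Ω) (W : (Matrix n n Ω)ˣ)
    (σ : Equiv.Perm n) (hW : (W.1.map φ)ᵀ * W.1.submatrix σ id = 1) (d : n → Ω) :
    ((W⁻¹.1 * diagonal d * W.1).map φ)ᵀ * (W⁻¹.1 * diagonal d * W.1) = 1 ↔
      ∀ i, φ (d i) * d (σ i) = 1 := by
  have hu := isUnit_submatrix_left W σ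
  set U := W.1.submatrix σ id with hU
  have hW' : U * (W.1.map φ)ᵀ = 1 := mul_eq_one_comm.1 hW
  have h2 : (W.1.map φ)ᵀ * (W⁻¹.1.map φ)ᵀ = 1 := by
    rw [← transpose_mul, ← Matrix.map_mul, Units.inv_mul, Matrix.map_one φ φ.map_zero φ.map_one,
      transpose_one]
  have h3 : (W⁻¹.1.map φ)ᵀ = U := by
    calc (W⁻¹.1.map φ)ᵀ = U * (W.1.map φ)ᵀ * (W⁻¹.1.map φ)ᵀ := by rw [hW', Matrix.one_mul]
      _ = U := by rw [Matrix.mul_assoc, h2, Matrix.mul_one]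
  have h1 : U * ((W⁻¹.1 * diagonal d * W.1).map φ)ᵀ = diagonal (φ ∘ d) * U := by
    rw [Matrix.map_mul, Matrix.map_mul, transpose_mul, transpose_mul, h3, ← Matrix.mul_assoc, hW',
      Matrix.one_mul, diagonal_map (map_zero φ), diagonal_transpose]
    rfl
  rw [← hu.mul_right_inj, ← Matrix.mul_assoc, h1, Matrix.mul_assoc, conj_diagonal_eq_submatrix,
    ← Matrix.mul_assoc, diagonal_mul_diagonal, Matrix.mul_one, ← hU]
  nth_rewrite 2 [← Matrix.one_mul U]
  rw [hu.mul_left_inj, ← diagonal_one, diagonal_eq_diagonal_iff]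
  rfl
end

/-! ### Orthonormal bases of Hermitian forms -/

section
variable {K : Type*} [Field K]

/-- The sesquilinear form with Gram matrix `H`, linear in the second variable. -/
def sesqForm {n : Type*} [Fintype n] (φ : K →+* K) (H : Matrix n n K) (x y : n → K) : K :=
  (φ ∘ x) ⬝ᵥ (H *ᵥ y)

variable {n : Type*} [Fintype n] {φ : K →+* K} {H : Matrix n n K}

theorem sesqForm_add_right (x y z : n → K) :
    sesqForm φ H x (y + z) = sesqForm φ H x y + sesqForm φ H x z := by
  simp [sesqForm, mulVec_add]

theorem sesqForm_smul_right (c : K) (x y : n → K) :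
    sesqForm φ H x (c • y) = c * sesqForm φ H x y := by
  simp [sesqForm, mulVec_smul]

theorem sesqForm_add_left (x y z : n → K) :
    sesqForm φ H (x + y) z = sesqForm φ H x z + sesqForm φ H y z := by
  have : φ ∘ (x + y) = φ ∘ x + φ ∘ y := by ext; simp
  simp [sesqForm, this]

theorem sesqForm_smul_left (c : K) (x y : n → K) :
    sesqForm φ H (c • x) y = φ c * sesqForm φ H x y := by
  have : φ ∘ (c • x) = φ c • (φ ∘ x) := by ext; simp
  simp [sesqForm, this]

theorem map_sesqForm (hφ : ∀ x, φ (φ x) = x) (hH : (H.map φ)ᵀ = H) (x y : n → K) :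
    φ (sesqForm φ H x y) = sesqForm φ H y x := by
  have h1 : φ ∘ (φ ∘ x) = x := by ext; simp [hφ]
  rw [sesqForm, sesqForm, RingHom.map_dotProduct, h1]
  have h2 : φ ∘ (H *ᵥ y) = H.map φ *ᵥ (φ ∘ y) := by
    ext i
    simp [mulVec, dotProduct]
  rw [h2, dotProduct_comm, ← vecMul_transpose, hH, dotProduct_mulVec]

/-- Orthonormal families of every size up to the dimension exist for a nondegenerate Hermitian form,
provided that the norm map onto the fixed field is surjective and the trace map is not zero. -/
theorem exists_orthonormal_family [DecidableEq n] (hφ : ∀ x, φ (φ x) = x)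
    (hnorm : ∀ c, φ c = c → c ≠ 0 → ∃ x, φ x * x = c) (htr : ∃ t, t + φ t ≠ 0)
    (hH : (H.map φ)ᵀ = H) (hu : IsUnit H) (r : ℕ) (hr : r ≤ Fintype.card n) :
    ∃ e : Fin r → n → K, ∀ i j, sesqForm φ H (e i) (e j) = if i = j then 1 else 0 := by
  induction r with
  | zero => exact ⟨fun i => i.elim0, fun i => i.elim0⟩
  | succ r ih =>
    obtain ⟨e, he⟩ := ih (by omega)
    let L : (n → K) →ₗ[K] (Fin r → K) :=
      { toFun := fun x i => sesqForm φ H (e i) x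
        map_add' := fun x y => by ext i; simp [sesqForm_add_right]
        map_smul' := fun c x => by ext i; simp [sesqForm_smul_right] }
    -- a nonzero vector `u` in the orthogonal complement of the family
    obtain ⟨u, hu1, hu0⟩ : ∃ u ∈ LinearMap.ker L, u ≠ 0 :=
      Submodule.exists_mem_ne_zero_of_ne_bot
        (LinearMap.ker_ne_bot_of_finrank_lt (by simpa using hr))
    have hLu : ∀ i, sesqForm φ H (e i) u = 0 := fun i => congrFun (LinearMap.mem_ker.1 hu1) i
    -- a vector `y` of the orthogonal complement which is not orthogonal to `u`
    obtain ⟨y₀, hy₀⟩ : ∃ y, sesqForm φ H u y ≠ 0 := by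
      by_contra! hall
      apply hu0
      obtain ⟨U, rfl⟩ := hu
      have h1 : φ ∘ u = 0 := by
        refine dotProduct_eq_zero _ fun w => ?_
        have := hall (U⁻¹.1 *ᵥ w)
        rwa [sesqForm, mulVec_mulVec, Units.mul_inv, one_mulVec] at this
      ext i
      have h2 : φ (u i) = 0 := congrFun h1 i
      simpa using h2
    have hsum : ∀ (x : n → K) (c : Fin r → K), sesqForm φ H x (∑ i, c i • e i) =
        ∑ i, c i * sesqForm φ H x (e i) := by
      intro x c
      simp only [sesqForm, mulVec_sum, dotProduct_sum, mulVec_smul, dotProduct_smul, smul_eq_mul]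
    obtain ⟨y, hy, hLy⟩ : ∃ y, sesqForm φ H u y ≠ 0 ∧ ∀ i, sesqForm φ H (e i) y = 0 := by
      refine ⟨y₀ + ∑ i, (-sesqForm φ H (e i) y₀) • e i, ?_, fun i => ?_⟩
      · rw [sesqForm_add_right, hsum]
        have : ∀ i, sesqForm φ H u (e i) = 0 := fun i => by
          rw [← map_sesqForm hφ hH, hLu, map_zero]
        simpa [this] using hy₀
      · rw [sesqForm_add_right, hsum]
        simp [he]
    -- an anisotropic combination of `u` and `y`
    obtain ⟨v, hv, hLv⟩ : ∃ v, sesqForm φ H v v ≠ 0 ∧ ∀ i, sesqForm φ H (e i) v = 0 := by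
      by_contra! hall
      have hiso : ∀ w, (∀ i, sesqForm φ H (e i) w = 0) → sesqForm φ H w w = 0 := by
        intro w hw
        by_contra h
        obtain ⟨i, hi⟩ := hall w h
        exact hi (hw i)
      obtain ⟨t, ht⟩ := htr
      set c := t / sesqForm φ H u y with hc
      have hw := hiso (u + c • y) (fun i => by
        rw [sesqForm_add_right, sesqForm_smul_right, hLu, hLy]; simp)
      rw [sesqForm_add_right, sesqForm_add_left, sesqForm_add_left, sesqForm_smul_right,
        sesqForm_smul_right, hiso u hLu, sesqForm_smul_left, sesqForm_smul_left, hiso y hLy,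
        ← map_sesqForm hφ hH u y] at hw
      have hct : c * sesqForm φ H u y = t := div_mul_cancel₀ _ hy
      rw [← map_mul, hct] at hw
      apply ht
      rw [← hw]; ring
    obtain ⟨x, hx⟩ := hnorm _ (map_sesqForm hφ hH v v) hv
    have hx0 : x ≠ 0 := by
      rintro rfl
      rw [mul_zero] at hx
      exact hv hx.symm
    have hv' : ∀ i, sesqForm φ H (e i) (x⁻¹ • v) = 0 := fun i => by
      rw [sesqForm_smul_right, hLv, mul_zero]
    refine ⟨Fin.snoc e (x⁻¹ • v), fun i j => ?_⟩
    induction i using Fin.lastCases with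
    | last =>
      induction j using Fin.lastCases with
      | last =>
        have hx1 : φ x ≠ 0 := by simpa using hx0
        simp only [Fin.snoc_last, if_true]
        rw [sesqForm_smul_left, sesqForm_smul_right, ← hx, map_inv₀]
        field_simp
      | cast j =>
        simp only [Fin.snoc_last, Fin.snoc_castSucc]
        rw [← map_sesqForm hφ hH, hv', map_zero, if_neg (Fin.castSucc_lt_last j).ne']
    | cast i =>
      induction j using Fin.lastCases with
      | last =>
        simp only [Fin.snoc_last, Fin.snoc_castSucc]
        rw [hv', if_neg (Fin.castSucc_lt_last i).ne]
      | cast j =>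
        simp only [Fin.snoc_castSucc, he, Fin.castSucc_inj]

/-- Hermitian Gram matrices are congruent to the identity matrix. -/
theorem exists_transpose_map_mul_mul_eq_one {k : ℕ} {H : Matrix (Fin k) (Fin k) K}
    (hφ : ∀ x, φ (φ x) = x)
    (hnorm : ∀ c, φ c = c → c ≠ 0 → ∃ x, φ x * x = c) (htr : ∃ t, t + φ t ≠ 0)
    (hH : (H.map φ)ᵀ = H) (hu : IsUnit H) :
    ∃ P : Matrix (Fin k) (Fin k) K, (P.map φ)ᵀ * H * P = 1 := by
  obtain ⟨e, he⟩ := exists_orthonormal_family hφ hnorm htr hH hu k (by simp)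
  refine ⟨(of e)ᵀ, ?_⟩
  ext i j
  rw [one_apply, ← he i j, sesqForm, Matrix.mul_assoc]
  rfl
end

/-! ### Special linear and special unitary groups -/

theorem exists_algebraMap_eq_of_pow_card_eq {K Ω : Type*} [Field K] [Finite K] [Field Ω]
    [Algebra K Ω] {x : Ω}
    (hx : x ^ Nat.card K = x) : ∃ y : K, algebraMap K Ω y = x := by
  have hne : (Polynomial.X ^ Nat.card K - Polynomial.X : Polynomial K) ≠ 0 :=
    FiniteField.X_pow_card_sub_X_ne_zero K Finite.one_lt_card
  exact (Polynomial.splits_X_pow_nat_card_sub_X (K := K)).mem_range_of_isRoot hne (by simp [hx])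

theorem exists_map_algebraMap_eq {K Ω : Type*} [Field K] [Finite K] [Field Ω] [Algebra K Ω]
    {m n : Type*}
    {A : Matrix m n Ω} (hA : ∀ i j, A i j ^ Nat.card K = A i j) :
    ∃ B : Matrix m n K, B.map (algebraMap K Ω) = A := by
  choose B hB using fun i j => exists_algebraMap_eq_of_pow_card_eq (K := K) (hA i j)
  exact ⟨of B, by ext i j; exact hB i j⟩

theorem algebraMap_matrix_injective {K Ω : Type*} [Field K] [Field Ω] [Algebra K Ω]
    {m n : Type*} :
    Function.Injective (fun B : Matrix m n K => B.map (algebraMap K Ω)) :=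
  Matrix.map_injective (algebraMap K Ω).injective

theorem det_eq_one_of_det_map {K Ω : Type*} [Field K] [Field Ω] [Algebra K Ω]
    {n : Type*} [Fintype n] [DecidableEq n] {B : Matrix n n K}
    (h : (B.map (algebraMap K Ω)).det = 1) : B.det = 1 := by
  apply (algebraMap K Ω).injective
  rw [RingHom.map_det, map_one]
  exact h

/-- The representation of `SL_n(K)` by matrices over an extension field `Ω`. -/
def mapMatrixHom (n K Ω : Type*) [Fintype n] [DecidableEq n] [Field K] [Field Ω] [Algebra K Ω] :
    SpecialLinearGroup n K →* Matrix n n Ω where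
  toFun A := A.1.map (algebraMap K Ω)
  map_one' := Matrix.map_one _ (map_zero _) (map_one _)
  map_mul' _ _ := Matrix.map_mul

theorem det_conj_diagonal {Ω : Type*} [Field Ω] {n : Type*} [Fintype n] [DecidableEq n]
    (W : (Matrix n n Ω)ˣ) (d : n → Ωˣ) (hd : ∏ i, d i = 1) :
    (W⁻¹.1 * diagonal (fun i => (d i : Ω)) * W.1).det = 1 := by
  rw [det_mul_comm, ← Matrix.mul_assoc, Units.mul_inv, Matrix.one_mul, det_diagonal,
    ← Units.coe_prod, hd, Units.val_one]

theorem card_le_of_mulEquiv_SLq {k p f M : ℕ} [Fact p.Prime] (hk : 1 ≤ k) (hf : 1 ≤ f)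
    (hM : 1 ≤ M) {G : Type*} [Group G] [Finite G] (e : G ≃* SLq (k + 1) p f)
    (hbig : (24 * M) ^ 4 ≤ (p ^ f) ^ (k + 1)) :
    Nat.card G ≤ 2 * (k + 1) * M * {y : G | ∃ g, g ^ M = y}.ncard := by
  let K := GaloisField p f
  let Ω := AlgebraicClosure K
  have : CharP Ω p := charP_of_injective_algebraMap (algebraMap K Ω).injective p
  have hcard : Nat.card K = p ^ f := GaloisField.card p f (by omega)
  have hq : 2 ≤ p ^ f := (Fact.out : p.Prime).two_le.trans (Nat.le_self_pow (by omega) _)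
  have hq0 : ((p ^ f : ℕ) : Ω) = 0 := by
    rw [Nat.cast_pow, CharP.cast_eq_zero, zero_pow (by omega)]
  let φ := iterateFrobenius Ω p f
  have hφ : ∀ x, φ x = x ^ p ^ f := fun x => iterateFrobenius_def p f x
  obtain ⟨V, hV⟩ := exists_map_frobenius_eq_submatrix hk hq hq0 φ hφ
  let j : G →* Matrix (Fin (k + 1)) (Fin (k + 1)) Ω :=
    (mapMatrixHom (Fin (k + 1)) K Ω).comp e.toMonoidHom
  have hj : ∀ g, j g = (e g).1.map (algebraMap K Ω) := fun g => rfl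
  refine card_le_mul_ncard_powers (Q := ((p ^ f : ℕ) : ℤ)) hk (by simpa using hq)
    (by exact_mod_cast hq0) j ?_ ?_ V ?_ hM (by simpa using hbig)
  · intro g h hgh
    exact e.injective (Subtype.ext (algebraMap_matrix_injective (Ω := Ω) hgh))
  · intro g
    have := congrArg (algebraMap K Ω) (e g).2
    rwa [RingHom.map_det, map_one] at this
  · intro d hd
    have h1 := map_conj_diagonal_eq_self_iff φ V (finRotate (k + 1)) hV (fun i => (d i : Ω))
    have h2 : (∀ i, d (finRotate (k + 1) i) = d i ^ ((p ^ f : ℕ) : ℤ)) ↔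
        ∀ i, (d (finRotate (k + 1) i) : Ω) = φ (d i) := by
      refine forall_congr' fun i => ?_
      rw [hφ, zpow_natCast, Units.ext_iff, Units.val_pow_eq_pow_val]
    rw [h2, ← h1]
    constructor
    · rintro ⟨g, hg⟩
      rw [← hg, hj]
      ext a b
      simp only [map_apply]
      rw [hφ, ← map_pow, ← hcard]
      have := Fintype.ofFinite K
      rw [Nat.card_eq_fintype_card, FiniteField.pow_card]
    · intro h
      obtain ⟨B, hB⟩ := exists_map_algebraMap_eq (K := K) (fun a b => by
        rw [hcard, ← hφ]
        exact congrFun (congrFun h a) b)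
      obtain ⟨g, hg⟩ := e.surjective
        ⟨B, det_eq_one_of_det_map (Ω := Ω) (by rw [hB, det_conj_diagonal V d hd])⟩
      exact ⟨g, by rw [hj, hg]; exact hB⟩

/-- A matrix whose rows are permuted cyclically by the composition of Frobenius and inverse
transpose. -/
theorem exists_transpose_map_mul_submatrix_eq_one {k p f : ℕ} [Fact p.Prime] (hk : 1 ≤ k)
    (hf : 1 ≤ f) {K Ω : Type*} [Field K] [Finite K] [CharP K p]
    (hcard : Nat.card K = (p ^ f) ^ 2) [Field Ω] [IsAlgClosed Ω] [CharP Ω p] [Algebra K Ω] :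
    ∃ W : (Matrix (Fin (k + 1)) (Fin (k + 1)) Ω)ˣ,
      (W.1.map (iterateFrobenius Ω p f))ᵀ * W.1.submatrix (finRotate (k + 1)) id = 1 := by
  set q := p ^ f with hqdef
  have hq : 2 ≤ q := (Fact.out : p.Prime).two_le.trans (Nat.le_self_pow (by omega) _)
  have hq0 : (q : Ω) = 0 := by
    rw [hqdef, Nat.cast_pow, CharP.cast_eq_zero, zero_pow (by omega)]
  set φ := iterateFrobenius Ω p f
  have hφ : ∀ x, φ x = x ^ q := fun x => iterateFrobenius_def p f x
  let ψ := iterateFrobenius K p f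
  have hψ : ∀ x, ψ x = x ^ q := fun x => iterateFrobenius_def p f x
  have hφψ : ∀ x, algebraMap K Ω (ψ x) = φ (algebraMap K Ω x) := fun x => by
    rw [hψ, hφ, map_pow]
  have hmap : ∀ B : Matrix (Fin (k + 1)) (Fin (k + 1)) K,
      (B.map ψ).map (algebraMap K Ω) = (B.map (algebraMap K Ω)).map φ := fun B => by
    ext a b; exact hφψ _
  obtain ⟨V, hV⟩ := exists_map_frobenius_eq_submatrix hk hq hq0 φ hφ
  have hVH : (V.1.map φ)ᵀ * V.1.submatrix (finRotate (k + 1)) id = V.1ᵀ * V.1 := by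
    rw [hV, transpose_submatrix, submatrix_mul_equiv]
    rfl
  have hHφ : (V.1ᵀ * V.1).map φ = V.1ᵀ * V.1 := by
    rw [Matrix.map_mul, transpose_map]
    conv_lhs => rw [hV]
    rw [← hVH, hV]
  have hHe : ∀ a b, φ ((V.1ᵀ * V.1) a b) = (V.1ᵀ * V.1) a b := fun a b =>
    congrFun (congrFun hHφ a) b
  obtain ⟨H, hH⟩ := exists_map_algebraMap_eq (K := K) (A := V.1ᵀ * V.1) (fun a b => by
    rw [hcard, pow_two, pow_mul, ← hφ, ← hφ, hHe, hHe])
  have hHψ : H.map ψ = H := by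
    apply algebraMap_matrix_injective (Ω := Ω)
    simp only
    rw [hmap, hH, hHφ]
  have hHt : Hᵀ = H := by
    apply algebraMap_matrix_injective (Ω := Ω)
    simp only
    rw [transpose_map, hH, transpose_mul, transpose_transpose]
  have hHu : IsUnit H := by
    rw [isUnit_iff_isUnit_det, isUnit_iff_ne_zero]
    intro h0
    have h1 := congrArg (algebraMap K Ω) h0
    rw [RingHom.map_det, map_zero] at h1
    change (H.map (algebraMap K Ω)).det = 0 at h1
    rw [hH, det_mul, det_transpose, mul_self_eq_zero] at h1
    exact ((isUnit_iff_isUnit_det _).1 V.isUnit).ne_zero h1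
  have hψψ : ∀ x, ψ (ψ x) = x := fun x => by
    have := Fintype.ofFinite K
    rw [hψ, hψ, ← pow_mul, ← pow_two, ← hcard, Nat.card_eq_fintype_card, FiniteField.pow_card]
  have hnorm : ∀ c, ψ c = c → c ≠ 0 → ∃ x, ψ x * x = c := by
    intro c hc hc0
    -- a root of `x ^ (q + 1) = c` is fixed by the Frobenius map of `K`
    obtain ⟨x, hx⟩ := IsAlgClosed.exists_pow_nat_eq (algebraMap K Ω c) (n := q + 1) (by omega)
    have hx0 : x ^ q ≠ 0 := by
      intro h
      rw [pow_succ, h, zero_mul] at hx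
      exact hc0 ((algebraMap K Ω).injective (by rw [← hx, map_zero]))
    obtain ⟨y, rfl⟩ := exists_algebraMap_eq_of_pow_card_eq (K := K) (x := x) (by
      rw [hcard]
      apply mul_left_cancel₀ hx0
      rw [← pow_succ, hx, ← hc, hψ, map_pow, ← hx]
      ring)
    refine ⟨y, (algebraMap K Ω).injective ?_⟩
    rw [hψ, ← pow_succ, map_pow, hx]
  have htr : ∃ t, t + ψ t ≠ 0 := by
    by_contra! hall
    have := Fintype.ofFinite K
    have hdeg : (Polynomial.X ^ q + Polynomial.X : Polynomial K).natDegree = q := by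
      rw [Polynomial.natDegree_add_eq_left_of_natDegree_lt] <;> simp
      omega
    have h0 : (Polynomial.X ^ q + Polynomial.X : Polynomial K) = 0 := by
      apply Polynomial.eq_zero_of_natDegree_lt_card_of_eval_eq_zero _ (f := id)
        Function.injective_id
      · intro t
        have := hall t
        rw [hψ, add_comm] at this
        simpa using this
      · rw [hdeg, ← Nat.card_eq_fintype_card, hcard]
        nlinarith
    rw [h0, Polynomial.natDegree_zero] at hdeg
    omega
  obtain ⟨P, hP⟩ := exists_transpose_map_mul_mul_eq_one hψψ hnorm htr (by rw [hHψ, hHt]) hHu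
  set P' := P.map (algebraMap K Ω) with hP'
  have hP1 : (P'.map φ)ᵀ * (V.1ᵀ * V.1) * P' = 1 := by
    have := congrArg (fun X => X.map (algebraMap K Ω)) hP
    simp only [Matrix.map_mul] at this
    rwa [transpose_map, hmap, hH, Matrix.map_one _ (map_zero _) (map_one _)] at this
  have hPu : IsUnit P' := IsUnit.of_mul_eq_one_right _ hP1
  obtain ⟨W, hW⟩ := V.isUnit.mul hPu
  refine ⟨W, ?_⟩
  have hsub : (V.1 * P').submatrix (finRotate (k + 1)) id =
      V.1.submatrix (finRotate (k + 1)) id * P' := by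
    have := submatrix_mul_equiv V.1 P' (finRotate (k + 1)) (Equiv.refl _) id
    simpa using this.symm
  rw [hW, hsub, Matrix.map_mul, transpose_mul, Matrix.mul_assoc, ← Matrix.mul_assoc (V.1.map φ)ᵀ,
    hVH, ← Matrix.mul_assoc, hP1]

theorem card_le_of_mulEquiv_SUq {k p f M : ℕ} [Fact p.Prime] (hk : 1 ≤ k) (hf : 1 ≤ f)
    (hM : 1 ≤ M) {G : Type*} [Group G] [Finite G] (e : G ≃* SUq (k + 1) p f)
    (hbig : (24 * M) ^ 4 ≤ (p ^ f) ^ (k + 1)) :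
    Nat.card G ≤ 2 * (k + 1) * M * {y : G | ∃ g, g ^ M = y}.ncard := by
  let K := GaloisField p (2 * f)
  let Ω := AlgebraicClosure K
  have : CharP Ω p := charP_of_injective_algebraMap (algebraMap K Ω).injective p
  have hcard : Nat.card K = (p ^ f) ^ 2 := by
    rw [← pow_mul, mul_comm f]
    exact GaloisField.card p (2 * f) (by omega)
  have hq : 2 ≤ p ^ f := (Fact.out : p.Prime).two_le.trans (Nat.le_self_pow (by omega) _)
  have hq0 : ((p ^ f : ℕ) : Ω) = 0 := by
    rw [Nat.cast_pow, CharP.cast_eq_zero, zero_pow (by omega)]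
  obtain ⟨W, hW⟩ := exists_transpose_map_mul_submatrix_eq_one (k := k) (p := p) (f := f) (K := K)
    (Ω := Ω) hk hf hcard
  set φ := iterateFrobenius Ω p f
  have hφ : ∀ x, φ x = x ^ p ^ f := fun x => iterateFrobenius_def p f x
  let j : G →* Matrix (Fin (k + 1)) (Fin (k + 1)) Ω :=
    (mapMatrixHom (Fin (k + 1)) K Ω).comp ((SUq (k + 1) p f).subtype.comp e.toMonoidHom)
  have hj : ∀ g, j g = (e g).1.1.map (algebraMap K Ω) := fun g => rfl
  have hmap : ∀ B : Matrix (Fin (k + 1)) (Fin (k + 1)) K,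
      ((B.map (fun x => x ^ p ^ f))ᵀ * B).map (algebraMap K Ω) =
        ((B.map (algebraMap K Ω)).map φ)ᵀ * B.map (algebraMap K Ω) := fun B => by
    rw [Matrix.map_mul, transpose_map]
    congr 2
    ext a b
    simp [hφ]
  refine card_le_mul_ncard_powers (Q := -((p ^ f : ℕ) : ℤ)) hk (by simpa using hq)
    (by rw [Int.cast_neg, Int.cast_natCast, hq0, neg_zero]) j ?_ ?_ W ?_ hM (by simpa using hbig)
  · intro g h hgh
    exact e.injective (Subtype.ext (Subtype.ext (algebraMap_matrix_injective (Ω := Ω) hgh)))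
  · intro g
    have := congrArg (algebraMap K Ω) (e g).1.2
    rwa [RingHom.map_det, map_one] at this
  · intro d hd
    have h1 := transpose_map_conj_diagonal_mul_eq_one_iff φ W (finRotate (k + 1)) hW
      (fun i => (d i : Ω))
    have h2 : (∀ i, d (finRotate (k + 1) i) = d i ^ (-((p ^ f : ℕ) : ℤ))) ↔
        ∀ i, φ (d i) * (d (finRotate (k + 1) i) : Ω) = 1 := by
      refine forall_congr' fun i => ?_
      rw [hφ, _root_.zpow_neg, zpow_natCast, eq_inv_iff_mul_eq_one, Units.ext_iff, Units.val_mul,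
        Units.val_pow_eq_pow_val, Units.val_one, mul_comm]
    rw [h2, ← h1]
    constructor
    · rintro ⟨g, hg⟩
      rw [← hg, hj, ← hmap, show (((e g).1.1.map (fun x => x ^ p ^ f))ᵀ * (e g).1.1) = 1 from
        (e g).2, Matrix.map_one _ (map_zero _) (map_one _)]
    · intro h
      set A := W⁻¹.1 * diagonal (fun i => (d i : Ω)) * W.1 with hA
      -- `A` and its image under the square of Frobenius are inverse to the same matrix
      have hA2 : (A.map φ).map φ = A := by
        have h3 := congrArg (fun X => X.map φ) h
        simp only [Matrix.map_mul] at h3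
        rw [transpose_map, Matrix.map_one _ (map_zero _) (map_one _)] at h3
        have h4 : A * (A.map φ)ᵀ = 1 := mul_eq_one_comm.1 h
        have h5 : A.map φ * Aᵀ = 1 := by
          rw [← transpose_transpose (A.map φ), ← transpose_mul, h4, transpose_one]
        have h6 : ((A.map φ).map φ)ᵀ = Aᵀ := left_inv_eq_right_inv h3 h5
        exact transpose_injective h6
      obtain ⟨B, hB⟩ := exists_map_algebraMap_eq (K := K) (A := A) (fun a b => by
        rw [hcard, pow_two, pow_mul, ← hφ, ← hφ]
        exact congrFun (congrFun hA2 a) b)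
      have hBdet : B.det = 1 :=
        det_eq_one_of_det_map (Ω := Ω) (by rw [hB, det_conj_diagonal W d hd])
      have hBU : (B.map (fun x => x ^ p ^ f))ᵀ * B = 1 := by
        apply algebraMap_matrix_injective (Ω := Ω)
        simp only
        rw [hmap, hB, h, Matrix.map_one _ (map_zero _) (map_one _)]
      obtain ⟨g, hg⟩ := e.surjective ⟨⟨B, hBdet⟩, hBU⟩
      exact ⟨g, by rw [hj, hg]; exact hB⟩

/-! ### The bound for large groups -/

theorem card_le_pow_of_injective {n q : ℕ} {K G : Type*} [Finite K] (hcard : Nat.card K ≤ q ^ 2)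
    (j : G → Matrix (Fin n) (Fin n) K) (hj : Function.Injective j) :
    Finite G ∧ Nat.card G ≤ (q ^ n) ^ (2 * n) := by
  refine ⟨Finite.of_injective j hj, (Nat.card_le_card_of_injective j hj).trans ?_⟩
  have : Nat.card (Matrix (Fin n) (Fin n) K) = (Nat.card K) ^ (n * n) := by
    rw [Matrix, Nat.card_fun, Nat.card_fun, Nat.card_fin, pow_mul]
  rw [this]
  calc (Nat.card K) ^ (n * n) ≤ (q ^ 2) ^ (n * n) := Nat.pow_le_pow_left hcard _
    _ = (q ^ n) ^ (2 * n) := by rw [← pow_mul, ← pow_mul]; ring_nf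

theorem theorem4p5 (M : ℕ) (hM : 1 ≤ M) :
    ∃ N : ℕ, ∀ (n p f : ℕ) [Fact p.Prime], 1 ≤ n → 1 ≤ f →
      ∀ (G : Type*) [Group G],
        (Nonempty (G ≃* SLq n p f) ∨ Nonempty (G ≃* SUq n p f)) →
        N ≤ Nat.card G →
        (Nat.card G : ℝ) / (2 * n * M) ≤ (wordImage (powerWord M) G).ncard := by
  set b := (24 * M) ^ 4 with hb
  have hb1 : 1 ≤ b := Nat.one_le_pow _ _ (by omega)
  refine ⟨b ^ (2 * b) + 1, ?_⟩
  intro n p f _ hn hf G _ hG hN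
  have hq : 2 ≤ p ^ f := (Fact.out : p.Prime).two_le.trans (Nat.le_self_pow (by omega) _)
  have hK1 : Nat.card (GaloisField p f) ≤ (p ^ f) ^ 2 := by
    rw [GaloisField.card p f (by omega)]
    exact Nat.le_self_pow two_ne_zero _
  have hK2 : Nat.card (GaloisField p (2 * f)) ≤ (p ^ f) ^ 2 := by
    rw [GaloisField.card p (2 * f) (by omega), ← pow_mul, mul_comm f]
  obtain ⟨hfin, hle⟩ : Finite G ∧ Nat.card G ≤ ((p ^ f) ^ n) ^ (2 * n) := by
    rcases hG with ⟨⟨e⟩⟩ | ⟨⟨e⟩⟩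
    · exact card_le_pow_of_injective hK1 (fun g => (e g).1)
        (fun g h hgh => e.injective (Subtype.ext hgh))
    · exact card_le_pow_of_injective hK2 (fun g => (e g).1.1)
        (fun g h hgh => e.injective (Subtype.ext (Subtype.ext hgh)))
  -- `n < q ^ n`, so a bound for `q ^ n` gives one for `|G| ≤ (q ^ n) ^ (2 * n)`
  have hbig : b ≤ (p ^ f) ^ n := by
    by_contra! hlt
    have hnb : n < b := lt_of_lt_of_le (Nat.lt_pow_self (by omega)) hlt.le
    have : ((p ^ f) ^ n) ^ (2 * n) ≤ b ^ (2 * b) :=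
      (Nat.pow_le_pow_left hlt.le _).trans (Nat.pow_le_pow_right hb1 (by omega))
    omega
  have hn2 : n ≠ 1 := by
    rintro rfl
    have : Subsingleton G := by
      rcases hG with ⟨⟨e⟩⟩ | ⟨⟨e⟩⟩
      · exact e.toEquiv.subsingleton
      · exact e.toEquiv.subsingleton
    have h1 : Nat.card G ≤ 1 := Finite.card_le_one_iff_subsingleton.2 this
    have h2 : 1 ≤ b ^ (2 * b) := Nat.one_le_pow _ _ hb1
    omega
  obtain ⟨k, rfl⟩ : ∃ k, n = k + 1 := ⟨n - 1, by omega⟩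
  have key : Nat.card G ≤ 2 * (k + 1) * M * {y : G | ∃ g, g ^ M = y}.ncard := by
    rcases hG with ⟨⟨e⟩⟩ | ⟨⟨e⟩⟩
    · exact card_le_of_mulEquiv_SLq (by omega) hf hM e hbig
    · exact card_le_of_mulEquiv_SUq (by omega) hf hM e hbig
  have hset : wordImage (powerWord M) G = {y : G | ∃ g, g ^ M = y} :=
    Set.ext fun y => mem_wordImage_powerWord M y
  have hM' : (0 : ℝ) < M := by exact_mod_cast hM
  rw [hset, div_le_iff₀ (by positivity), mul_comm]
  exact_mod_cast key
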